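/- Let $G$ be an Abelian group (finite or infinite) and $n \ge 0$ an integer. Let $\mathcal{P}_1(\{0,1\}^n, G)$ be the set of functions $P : \{0,1\}^n \to G$ of the form $P(x) = c_0 + \sum_{i=1}^n c_i x_i$ with $c_0, c_1, \ldots, c_n \in G$, where $c_i x_i$ means $c_i$ if $x_i = 1$ and $0$ if $x_i = 0$. For $f, g : \{0,1\}^n \to G$ let $\delta(f,g) = |\{x \in \{0,1\}^n : f(x) \neq g(x)\}| / 2^n$. Theorem. There is an absolute polynomial $L \in \mathbb{R}[X]$ such that for every $\varepsilon > 0$, every integer $n \ge 0$, every Abelian group $G$ and every function $f : \{0,1\}^n \to G$, the set $\{P \in \mathcal{P}_1(\{0,1\}^n, G) : \delta(f,P) \le \tfrac12 - \varepsilon\}$ is finite and has at most $L(1/\varepsilon)$ elements. In other words, $\mathcal{P}_1(\{0,1\}^n, G)$ is $(\tfrac12 - \varepsilon, \mathrm{poly}(1/\varepsilon))$-list decodable, with a polynomial that depends on none of $\varepsilon$, $n$, $G$. -/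

import Mathlib

/-- The Boolean cube `{0,1}^n`; `true` stands for `1` and `false` for `0`. -/
abbrev BoolCube (n : ℕ) : Type := Fin n → Bool

/-- The monomial `g · ∏_{i ∈ S} x_i` with coefficient `g` in an Abelian group: it takes the
value `g` at the points `x` with `x_i = 1` for all `i ∈ S`, and the value `0` elsewhere. -/
def groupMonomial {n : ℕ} {G : Type*} [AddCommGroup G] (S : Finset (Fin n)) (g : G)
    (x : BoolCube n) : G :=
  if ∀ i ∈ S, x i = true then g else 0

/-- `P_d({0,1}^n, G)`: the functions `{0,1}^n → G` which are a sum of monomials of degree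
at most `d`, that is `P(x) = ∑_{|S| ≤ d} c_S ∏_{i ∈ S} x_i` with coefficients `c_S ∈ G`. -/
def polySpace (d n : ℕ) (G : Type*) [AddCommGroup G] : Set (BoolCube n → G) :=
  {P | ∃ c : Finset (Fin n) → G,
    ∀ x, P x = ∑ S : Finset (Fin n) with S.card ≤ d, groupMonomial S (c S) x}

open Classical in
/-- The relative Hamming distance `δ(f, g)`: the fraction of points of `{0,1}^n` at which
`f` and `g` disagree. -/
noncomputable def relDist {n : ℕ} {G : Type*} (f g : BoolCube n → G) : ℝ :=
  (hammingDist f g : ℝ) / (Fintype.card (BoolCube n) : ℝ)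

/-- A family `F` of functions `{0,1}^n → G` is `(δ, L)`-list decodable if, for every function
`f`, there are (finitely many and) at most `L` elements of `F` at relative distance at most
`δ` from `f`. -/
def IsListDecodable {n : ℕ} {G : Type*} (F : Set (BoolCube n → G)) (δ L : ℝ) : Prop :=
  ∀ f : BoolCube n → G,
    {P ∈ F | relDist f P ≤ δ}.Finite ∧ ({P ∈ F | relDist f P ≤ δ}.ncard : ℝ) ≤ L

/-! Give each affine function at agreement `a` with `f` the weight `(2a - 1)₊²`. The total weight is
at most 1 (`sum_excessSq_agreement_le_one`), and a listed function has `a ≥ 1/2 + ε`, hence weight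
at least `(2ε)²`; so the list has at most `1/(4ε²)` members. The weight bound is an induction on
`n`: on the faces `x_0 = 0, 1` an affine function restricts to two with the same linear part, and
its agreement is the average of theirs. For a fixed linear part the agreements on a face sum to at
most 1, which makes averaging lossless (`sum_excessSq_half_add_le`). -/

/-- The quadratic truncation `(b - t)₊²` lies below its chord on `[0, M]`. -/
lemma mul_sum_posPart_sq_le {α : Type*} (Y : Finset α) (b : α → ℝ) {M t B : ℝ}
    (hb : ∀ y ∈ Y, 0 ≤ b y) (hM : ∀ y ∈ Y, b y ≤ M) (ht : 0 ≤ t) (htM : t ≤ M)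
    (hB : ∑ y ∈ Y, b y ≤ B) :
    M * ∑ y ∈ Y, (max 0 (b y - t)) ^ 2 ≤ (M - t) ^ 2 * B := by
  calc M * ∑ y ∈ Y, (max 0 (b y - t)) ^ 2 = ∑ y ∈ Y, M * (max 0 (b y - t)) ^ 2 :=
        Finset.mul_sum _ _ _
    _ ≤ ∑ y ∈ Y, (M - t) ^ 2 * b y := by
        refine Finset.sum_le_sum fun y hy => ?_
        have h0 := hb y hy
        have h1 := hM y hy
        rcases le_total (b y) t with h | h
        · rw [max_eq_left (by linarith)]
          have := mul_nonneg (sq_nonneg (M - t)) h0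
          simpa using this
        · rw [max_eq_right (by linarith)]
          have e1 : M * (b y - t) ≤ (M - t) * b y := by nlinarith
          have e2 : b y - t ≤ M - t := by linarith
          calc M * (b y - t) ^ 2 = (b y - t) * (M * (b y - t)) := by ring
            _ ≤ (M - t) * ((M - t) * b y) := by
                apply mul_le_mul e2 e1
                · exact mul_nonneg (by linarith) (by linarith)
                · linarith
            _ = (M - t) ^ 2 * b y := by ring
    _ = (M - t) ^ 2 * ∑ y ∈ Y, b y := (Finset.mul_sum _ _ _).symm
    _ ≤ (M - t) ^ 2 * B := mul_le_mul_of_nonneg_left hB (sq_nonneg _)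

/-- The squared excess of `2 * a` over `1`. -/
noncomputable def excessSq (a : ℝ) : ℝ := (max 0 (2 * a - 1)) ^ 2

lemma excessSq_nonneg (a : ℝ) : 0 ≤ excessSq a := sq_nonneg _

lemma excessSq_of_le {a : ℝ} (h : a ≤ 1 / 2) : excessSq a = 0 := by
  rw [excessSq, max_eq_left (by linarith)]; norm_num

lemma excessSq_half_add (a b : ℝ) : excessSq ((a + b) / 2) = (max 0 (b - (1 - a))) ^ 2 := by
  rw [excessSq]; congr 2; ring

lemma excessSq_of_ge {a : ℝ} (h : 1 / 2 ≤ a) : excessSq a = (2 * a - 1) ^ 2 := by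
  rw [excessSq, max_eq_right (by linarith)]

/-- The two-majority case of `sum_excessSq_half_add_le`. -/
lemma sum_excessSq_half_add_le_of_majorities {α β : Type*} (Y : Finset α) (Z : Finset β)
    (a : α → ℝ) (b : β → ℝ) (ha : ∀ y ∈ Y, 0 ≤ a y) (hb : ∀ z ∈ Z, 0 ≤ b z)
    (hA : ∑ y ∈ Y, a y ≤ 1) (hB : ∑ z ∈ Z, b z ≤ 1) {y₀ : α} (hy₀ : y₀ ∈ Y) {z₀ : β}
    (hz₀ : z₀ ∈ Z) (hz : 1 / 2 < b z₀) (hyz : b z₀ ≤ a y₀) :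
    ∑ y ∈ Y, ∑ z ∈ Z, excessSq ((a y + b z) / 2) ≤
      (∑ y ∈ Y, excessSq (a y) + ∑ z ∈ Z, excessSq (b z)) / 2 := by
  classical
  have hY := Finset.add_sum_erase Y a hy₀
  have hZ := Finset.add_sum_erase Z b hz₀
  have hb' : ∀ z ∈ Z.erase z₀, 0 ≤ b z := fun z h => hb z (Finset.mem_of_mem_erase h)
  have ha' : ∀ y ∈ Y.erase y₀, 0 ≤ a y := fun z h => ha z (Finset.mem_of_mem_erase h)
  have small_b : ∀ z ∈ Z.erase z₀, b z ≤ 1 - b z₀ := fun z h => by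
    have := Finset.single_le_sum hb' h
    linarith
  have small_a : ∀ y ∈ Y.erase y₀, a y ≤ 1 - a y₀ := fun y h => by
    have := Finset.single_le_sum ha' h
    linarith
  have ha1 : a y₀ ≤ 1 := by
    have := Finset.single_le_sum ha hy₀
    linarith
  have max_b : ∀ z ∈ Z, b z ≤ b z₀ := fun z h => by
    by_cases e : z = z₀
    · rw [e]
    · have := small_b z (Finset.mem_erase.2 ⟨e, h⟩)
      linarith
  -- For `y ≠ y₀`, `a y + b z ≤ (1 - a y₀) + b z₀ ≤ 1`, so the excess vanishes.
  have only : ∑ y ∈ Y, ∑ z ∈ Z, excessSq ((a y + b z) / 2) =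
      ∑ z ∈ Z, excessSq ((a y₀ + b z) / 2) := by
    refine Finset.sum_eq_single_of_mem y₀ hy₀ fun y hy hne => Finset.sum_eq_zero fun z h => ?_
    have h1 := small_a y (Finset.mem_erase.2 ⟨hne, hy⟩)
    have h2 := max_b z h
    exact excessSq_of_le (by linarith)
  have tail : ∑ z ∈ Z.erase z₀, excessSq ((a y₀ + b z) / 2) ≤ (a y₀ - b z₀) ^ 2 := by
    simp only [excessSq_half_add]
    have key := mul_sum_posPart_sq_le (Z.erase z₀) b (M := 1 - b z₀) (t := 1 - a y₀)
      (B := 1 - b z₀) hb' small_b (by linarith) (by linarith) (by linarith)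
    -- The factor `M = 1 - b z₀` cancels unless it is 0, and then the tail vanishes.
    rcases (show b z₀ ≤ 1 by linarith).eq_or_lt with e | l
    · rw [Finset.sum_eq_zero]
      · exact sq_nonneg _
      · intro z h
        have := small_b z h
        rw [max_eq_left (by linarith)]; norm_num
    · have e : (1 - b z₀ - (1 - a y₀)) ^ 2 * (1 - b z₀) = (1 - b z₀) * (a y₀ - b z₀) ^ 2 := by
        ring
      rw [e] at key
      exact le_of_mul_le_mul_left key (by linarith)
  have r1 := Finset.single_le_sum (fun y _ => excessSq_nonneg (a y)) hy₀
  have r2 := Finset.single_le_sum (fun z _ => excessSq_nonneg (b z)) hz₀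
  rw [excessSq_of_ge (by linarith)] at r1 r2
  rw [only, ← Finset.add_sum_erase Z _ hz₀, excessSq_of_ge (by linarith)]
  -- Parallelogram law: `(A+B-1)² + (A-B)² = ((2A-1)² + (2B-1)²) / 2` for `A = a y₀`, `B = b z₀`.
  nlinarith

/-- The one-majority case of `sum_excessSq_half_add_le`. -/
lemma sum_excessSq_half_add_le_of_majority {α β : Type*} (Y : Finset α) (Z : Finset β)
    (a : α → ℝ) (b : β → ℝ) (ha : ∀ y ∈ Y, 0 ≤ a y) (hb : ∀ z ∈ Z, 0 ≤ b z)
    (hA : ∑ y ∈ Y, a y ≤ 1) (hB : ∑ z ∈ Z, b z ≤ 1) {y₀ : α} (hy₀ : y₀ ∈ Y)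
    (hy : 1 / 2 < a y₀) (hsmall : ∀ z ∈ Z, b z ≤ 1 / 2) :
    ∑ y ∈ Y, ∑ z ∈ Z, excessSq ((a y + b z) / 2) ≤
      (∑ y ∈ Y, excessSq (a y) + ∑ z ∈ Z, excessSq (b z)) / 2 := by
  classical
  have hY := Finset.add_sum_erase Y a hy₀
  have ha' : ∀ y ∈ Y.erase y₀, 0 ≤ a y := fun z h => ha z (Finset.mem_of_mem_erase h)
  have ha1 : a y₀ ≤ 1 := by
    have := Finset.single_le_sum ha hy₀
    linarith
  have only : ∑ y ∈ Y, ∑ z ∈ Z, excessSq ((a y + b z) / 2) =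
      ∑ z ∈ Z, excessSq ((a y₀ + b z) / 2) := by
    refine Finset.sum_eq_single_of_mem y₀ hy₀ fun y hy hne => Finset.sum_eq_zero fun z h => ?_
    have h1 := Finset.single_le_sum ha' (Finset.mem_erase.2 ⟨hne, hy⟩)
    have h2 := hsmall z h
    exact excessSq_of_le (by linarith)
  -- This bounds the sum by `2 (a y₀ - 1/2)²`, exactly half of `excessSq (a y₀)`.
  have key := mul_sum_posPart_sq_le Z b (M := 1 / 2) (t := 1 - a y₀) (B := 1) hb hsmall
    (by linarith) (by linarith) hB
  have r1 := Finset.single_le_sum (fun y _ => excessSq_nonneg (a y)) hy₀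
  have r2 : 0 ≤ ∑ z ∈ Z, excessSq (b z) := Finset.sum_nonneg fun z _ => excessSq_nonneg _
  rw [excessSq_of_ge (by linarith)] at r1
  rw [only]
  simp only [excessSq_half_add]
  nlinarith

/-- The sum of the squared excesses of all averages of an entry of `a` and an entry of `b` is at
most the average of the two sums of squared excesses. -/
lemma sum_excessSq_half_add_le {α β : Type*} (Y : Finset α) (Z : Finset β)
    (a : α → ℝ) (b : β → ℝ) (ha : ∀ y ∈ Y, 0 ≤ a y) (hb : ∀ z ∈ Z, 0 ≤ b z)
    (hA : ∑ y ∈ Y, a y ≤ 1) (hB : ∑ z ∈ Z, b z ≤ 1) :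
    ∑ y ∈ Y, ∑ z ∈ Z, excessSq ((a y + b z) / 2) ≤
      (∑ y ∈ Y, excessSq (a y) + ∑ z ∈ Z, excessSq (b z)) / 2 := by
  have swap : ∑ y ∈ Y, ∑ z ∈ Z, excessSq ((a y + b z) / 2) =
      ∑ z ∈ Z, ∑ y ∈ Y, excessSq ((b z + a y) / 2) := by
    rw [Finset.sum_comm]
    simp only [add_comm]
  by_cases h1 : ∃ y₀ ∈ Y, 1 / 2 < a y₀
  · obtain ⟨y₀, hy₀, hy⟩ := h1
    by_cases h2 : ∃ z₀ ∈ Z, 1 / 2 < b z₀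
    · obtain ⟨z₀, hz₀, hz⟩ := h2
      rcases le_total (b z₀) (a y₀) with h | h
      · exact sum_excessSq_half_add_le_of_majorities Y Z a b ha hb hA hB hy₀ hz₀ hz h
      · rw [swap, add_comm]
        exact sum_excessSq_half_add_le_of_majorities Z Y b a hb ha hB hA hz₀ hy₀ hy h
    · push Not at h2
      exact sum_excessSq_half_add_le_of_majority Y Z a b ha hb hA hB hy₀ hy h2
  · push Not at h1
    by_cases h2 : ∃ z₀ ∈ Z, 1 / 2 < b z₀
    · obtain ⟨z₀, hz₀, hz⟩ := h2
      rw [swap, add_comm]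
      exact sum_excessSq_half_add_le_of_majority Z Y b a hb ha hB hA hz₀ hz h1
    · push Not at h2
      rw [Finset.sum_eq_zero fun y hy => Finset.sum_eq_zero fun z hz => ?_]
      · have r1 : 0 ≤ ∑ y ∈ Y, excessSq (a y) := Finset.sum_nonneg fun _ _ => excessSq_nonneg _
        have r2 : 0 ≤ ∑ z ∈ Z, excessSq (b z) := Finset.sum_nonneg fun _ _ => excessSq_nonneg _
        linarith
      · have := h1 y hy
        have := h2 z hz
        exact excessSq_of_le (by linarith)

/-! ### Agreement with affine functions -/

section Affine

variable {n : ℕ} {G : Type*}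

open Classical in
/-- The fraction of points of the Boolean cube at which `f` and `g` agree. -/
noncomputable def agreement (f g : BoolCube n → G) : ℝ :=
  (∑ x, if f x = g x then (1 : ℝ) else 0) / 2 ^ n

lemma agreement_nonneg (f g : BoolCube n → G) : 0 ≤ agreement f g :=
  div_nonneg (Finset.sum_nonneg fun x _ => by split_ifs <;> norm_num) (by positivity)

lemma agreement_le_one (f g : BoolCube n → G) : agreement f g ≤ 1 := by
  rw [agreement, div_le_one (by positivity)]
  calc _ ≤ ∑ _x : BoolCube n, (1 : ℝ) :=
        Finset.sum_le_sum fun x _ => by split_ifs <;> norm_num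
    _ = 2 ^ n := by simp

lemma agreement_eq_one_sub_relDist (f g : BoolCube n → G) :
    agreement f g = 1 - relDist f g := by
  classical
  have h : (∑ x, if f x = g x then (1 : ℝ) else 0) + (hammingDist f g : ℝ) = 2 ^ n := by
    rw [hammingDist, Finset.card_filter, Nat.cast_sum, ← Finset.sum_add_distrib]
    rw [Finset.sum_congr rfl (g := fun _ => (1 : ℝ))]
    · simp
    · intro x _
      by_cases e : f x = g x <;> simp [e]
  have hc : (Fintype.card (BoolCube n) : ℝ) = 2 ^ n := by simp
  have hp : (2 : ℝ) ^ n ≠ 0 := by positivity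
  rw [agreement, relDist, hc, eq_sub_iff_add_eq, ← add_div, div_eq_one_iff_eq hp, ← h]

variable [AddCommGroup G]

/-- The affine function `x ↦ y + ∑ i, ℓ i * x i` on the Boolean cube. -/
def affineFun (ℓ : Fin n → G) (y : G) (x : BoolCube n) : G :=
  y + ∑ i, if x i = true then ℓ i else 0

lemma affineFun_cons (ℓ : Fin (n + 1) → G) (y : G) (t : Bool) (x : BoolCube n) :
    affineFun ℓ y (Fin.cons t x : BoolCube (n + 1)) =
      affineFun (Fin.tail ℓ) (if t = true then y + ℓ 0 else y) x := by
  simp only [affineFun, Fin.sum_univ_succ, Fin.cons_zero, Fin.cons_succ, Fin.tail]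
  cases t <;> simp [add_assoc]

/-- Distinct translates of one linear part never take the same value at a point, so their agreement
sets are disjoint. -/
lemma sum_agreement_affineFun_le_one (f : BoolCube n → G) (ℓ : Fin n → G) (Y : Finset G) :
    ∑ y ∈ Y, agreement f (affineFun ℓ y) ≤ 1 := by
  classical
  simp only [agreement]
  rw [← Finset.sum_div, div_le_one (by positivity), Finset.sum_comm]
  calc _ ≤ ∑ _x : BoolCube n, (1 : ℝ) := by
        refine Finset.sum_le_sum fun x _ => ?_
        have e : ∀ y, f x = affineFun ℓ y x ↔ f x - (∑ i, if x i = true then ℓ i else 0) = y :=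
          fun y => by rw [affineFun, sub_eq_iff_eq_add]
        simp only [e, Finset.sum_ite_eq]
        split_ifs <;> norm_num
    _ = 2 ^ n := by simp

lemma agreement_affineFun_succ (f : BoolCube (n + 1) → G) (ℓ : Fin (n + 1) → G) (y : G) :
    agreement f (affineFun ℓ y) =
      (agreement (fun x => f (Fin.cons false x)) (affineFun (Fin.tail ℓ) y) +
        agreement (fun x => f (Fin.cons true x)) (affineFun (Fin.tail ℓ) (y + ℓ 0))) / 2 := by
  classical
  simp only [agreement]
  rw [← Equiv.sum_comp (Fin.consEquiv fun _ : Fin (n + 1) => Bool), Fintype.sum_prod_type,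
    Fintype.sum_bool]
  simp only [Fin.consEquiv, Equiv.coe_fn_mk, affineFun_cons, if_true, Bool.false_eq_true, if_false]
  rw [pow_succ]
  field_simp
  ring

/-- The squared excess agreements of `f` with all affine functions sum up to at most `1`. -/
lemma sum_excessSq_agreement_le_one (f : BoolCube n → G) (W : Finset ((Fin n → G) × G)) :
    ∑ w ∈ W, excessSq (agreement f (affineFun w.1 w.2)) ≤ 1 := by
  classical
  induction n with
  | zero =>
    -- On `[1/2, 1]`, `(2a - 1)² ≤ a` since `(4a - 1)(a - 1) ≤ 0`.
    calc _ ≤ ∑ w ∈ W, agreement f (affineFun w.1 w.2) := by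
          refine Finset.sum_le_sum fun w _ => ?_
          have h0 := agreement_nonneg f (affineFun w.1 w.2)
          have h1 := agreement_le_one f (affineFun w.1 w.2)
          rcases le_total (agreement f (affineFun w.1 w.2)) (1 / 2) with h | h
          · rwa [excessSq_of_le h]
          · rw [excessSq_of_ge h]
            nlinarith
      _ = ∑ y ∈ W.image Prod.snd, agreement f (affineFun 0 y) := by
          rw [Finset.sum_image fun v _ w _ h => Prod.ext (Subsingleton.elim _ _) h]
          exact Finset.sum_congr rfl fun w _ => by rw [Subsingleton.elim w.1 0]
      _ ≤ 1 := sum_agreement_affineFun_le_one f 0 _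
  | succ n ih =>
    -- The common linear part and the constants on the two faces; their difference recovers `ℓ 0`.
    let φ : (Fin (n + 1) → G) × G → (Fin n → G) × G × G :=
      fun w => (Fin.tail w.1, w.2, w.2 + w.1 0)
    have hφ : Function.Injective φ := by
      rintro ⟨ℓ, y⟩ ⟨ℓ', y'⟩ h
      simp only [φ, Prod.mk.injEq] at h
      obtain ⟨h1, rfl, h3⟩ := h
      rw [← Fin.cons_self_tail ℓ, ← Fin.cons_self_tail ℓ', h1, add_left_cancel h3]
    let f₀ : BoolCube n → G := fun x => f (Fin.cons false x)
    let f₁ : BoolCube n → G := fun x => f (Fin.cons true x)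
    let T := W.image fun w => Fin.tail w.1
    let Y := W.image fun w => w.2
    let Z := W.image fun w => w.2 + w.1 0
    calc ∑ w ∈ W, excessSq (agreement f (affineFun w.1 w.2))
        = ∑ u ∈ W.image φ, excessSq ((agreement f₀ (affineFun u.1 u.2.1) +
            agreement f₁ (affineFun u.1 u.2.2)) / 2) := by
          rw [Finset.sum_image hφ.injOn]
          exact Finset.sum_congr rfl fun w _ => by rw [agreement_affineFun_succ]
      _ ≤ ∑ u ∈ T ×ˢ Y ×ˢ Z, excessSq ((agreement f₀ (affineFun u.1 u.2.1) +
            agreement f₁ (affineFun u.1 u.2.2)) / 2) := by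
          refine Finset.sum_le_sum_of_subset_of_nonneg ?_ fun _ _ _ => excessSq_nonneg _
          intro u hu
          obtain ⟨w, hw, rfl⟩ := Finset.mem_image.1 hu
          exact Finset.mem_product.2 ⟨Finset.mem_image_of_mem _ hw, Finset.mem_product.2
            ⟨Finset.mem_image_of_mem _ hw, Finset.mem_image_of_mem (fun w => w.2 + w.1 0) hw⟩⟩
      _ = ∑ ℓ ∈ T, ∑ y ∈ Y, ∑ z ∈ Z, excessSq ((agreement f₀ (affineFun ℓ y) +
            agreement f₁ (affineFun ℓ z)) / 2) := by
          simp only [Finset.sum_product]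
      _ ≤ ∑ ℓ ∈ T, (∑ y ∈ Y, excessSq (agreement f₀ (affineFun ℓ y)) +
            ∑ z ∈ Z, excessSq (agreement f₁ (affineFun ℓ z))) / 2 :=
          Finset.sum_le_sum fun ℓ _ => sum_excessSq_half_add_le Y Z _ _
            (fun _ _ => agreement_nonneg _ _) (fun _ _ => agreement_nonneg _ _)
            (sum_agreement_affineFun_le_one _ _ _) (sum_agreement_affineFun_le_one _ _ _)
      _ = (∑ w ∈ T ×ˢ Y, excessSq (agreement f₀ (affineFun w.1 w.2)) +
            ∑ w ∈ T ×ˢ Z, excessSq (agreement f₁ (affineFun w.1 w.2))) / 2 := by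
          simp only [Finset.sum_product]
          rw [← Finset.sum_div, Finset.sum_add_distrib]
      _ ≤ 1 := by
          have h0 := ih f₀ (T ×ˢ Y)
          have h1 := ih f₁ (T ×ˢ Z)
          linarith

lemma exists_eq_affineFun_of_mem_polySpace_one {P : BoolCube n → G} (hP : P ∈ polySpace 1 n G) :
    ∃ w : (Fin n → G) × G, P = affineFun w.1 w.2 := by
  classical
  obtain ⟨c, hc⟩ := hP
  refine ⟨(fun i => c {i}, c ∅), funext fun x => ?_⟩
  have hs : ({S : Finset (Fin n) | S.card ≤ 1} : Finset (Finset (Fin n))) =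
      insert ∅ (Finset.univ.image fun i => {i}) := by
    ext S
    simp [Nat.le_one_iff_eq_zero_or_eq_one, Finset.card_eq_one, eq_comm]
  rw [hc, hs, Finset.sum_insert (by simp),
    Finset.sum_image (Finset.singleton_injective.injOn)]
  simp [groupMonomial, affineFun]

end Affine

/-- One real polynomial `L`, chosen before `ε`, `n` and `G`, bounds the list size. -/
theorem theorem1p2 :
    ∃ L : Polynomial ℝ, ∀ ε : ℝ, 0 < ε → ∀ (n : ℕ) (G : Type*) [AddCommGroup G],
      IsListDecodable (polySpace 1 n G) (1 / 2 - ε) (L.eval (1 / ε)) := by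
  classical
  refine ⟨Polynomial.C (1 / 4) * Polynomial.X ^ 2, fun ε hε n G _ f => ?_⟩
  set A := {P ∈ polySpace 1 n G | relDist f P ≤ 1 / 2 - ε} with hA
  -- Finite subsets come first: a uniform bound on their sizes also yields finiteness of `A`.
  have bound : ∀ T : Finset (BoolCube n → G), (T : Set (BoolCube n → G)) ⊆ A →
      (T.card : ℝ) ≤ 1 / 4 * (1 / ε) ^ 2 := by
    intro T hT
    have ex : ∀ P : BoolCube n → G, ∃ w : (Fin n → G) × G, P ∈ T → P = affineFun w.1 w.2 := by
      intro P
      by_cases h : P ∈ T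
      · obtain ⟨w, hw⟩ := exists_eq_affineFun_of_mem_polySpace_one (hT h).1
        exact ⟨w, fun _ => hw⟩
      · exact ⟨0, fun h' => absurd h' h⟩
    choose w hw using ex
    have inj : Set.InjOn w T := fun P hP Q hQ h => by rw [hw P hP, hw Q hQ, h]
    have h1 := sum_excessSq_agreement_le_one f (T.image w)
    rw [Finset.sum_image inj] at h1
    have h2 : ∑ _P ∈ T, (2 * ε) ^ 2 ≤
        ∑ P ∈ T, excessSq (agreement f (affineFun (w P).1 (w P).2)) := by
      refine Finset.sum_le_sum fun P hP => ?_
      rw [← hw P hP, agreement_eq_one_sub_relDist]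
      have := (hT hP).2
      rw [excessSq_of_ge (by linarith)]
      exact pow_le_pow_left₀ (by linarith) (by linarith) 2
    rw [Finset.sum_const, nsmul_eq_mul] at h2
    have h3 : (T.card : ℝ) * (2 * ε) ^ 2 ≤ 1 := h2.trans h1
    rw [← le_div_iff₀ (by positivity)] at h3
    refine h3.trans_eq ?_
    field_simp
    norm_num
  have fin : A.Finite := by
    by_contra h
    obtain ⟨m, hm⟩ := exists_nat_gt (1 / 4 * (1 / ε) ^ 2)
    obtain ⟨T, hT, hc⟩ := Set.Infinite.exists_subset_card_eq h m
    have := bound T hT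
    rw [hc] at this
    linarith
  refine ⟨fin, ?_⟩
  rw [Set.ncard_eq_toFinset_card A fin]
  simpa using bound fin.toFinset (by simp)
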